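/- (Generalised graded uniqueness theorem) Let $E=(E^0,E^1,r,s)$ be an arbitrary directed graph (no finiteness or countability assumption), $R$ a commutative ring with identity, and $G$ an ordered group, i.e. a group with a total order such that $g\le h$ implies $fg\le fh$ and $gf\le hf$ for all $f,g,h\in G$. Let $G_+=\{g\in G : \varepsilon\le g,\ g\ne\varepsilon\}$, where $\varepsilon$ is the identity of $G$, and let $w:E^1\to G_+$ be a map. Let $L_R(E)$ be the Leavitt path algebra, i.e. the (not necessarily unital) associative $R$-algebra generated by $E^0\cup E^1\cup\{e^*: e\in E^1\}$ subject to the relations: $vv'=\delta_{v,v'}v$ for $v,v'\in E^0$; $s(e)e=e=e\,r(e)$ and $r(e)e^*=e^*=e^*s(e)$ for $e\in E^1$; $e^*f=\delta_{e,f}\,r(e)$ for $e,f\in E^1$; and $v=\sum_{s(e)=v}ee^*$ for each $v\in E^0$ with $s^{-1}(v)$ finite and non-empty. Give $L_R(E)$ the $G$-grading with $\deg v=\varepsilon$, $\deg e=w(e)$, $\deg e^*=w(e)^{-1}$; that is, its component of degree $g$ is the $R$-span of the products of generators whose degrees multiply to $g$. Let $A=\bigoplus_{g\in G}A_g$ be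 a $G$-graded $R$-algebra (possibly without unit): each $A_g$ is an $R$-submodule and $A_gA_h\subseteq A_{gh}$. Let $\pi:L_R(E)\to A$ be a homomorphism of $G$-graded $R$-algebras, i.e. an $R$-algebra homomorphism with $\pi(L_R(E)_g)\subseteq A_g$ for all $g\in G$. If $\pi(rv)\neq 0$ for all $v\in E^0$ and all $r\in R\setminus\{0\}$, then $\pi$ is injective. -/

import Mathlib

universe u v w x

/-- A directed graph `(E⁰, E¹, r, s)` with vertex set `V`, edge set `E`, source map `s` and range map
`r`.  No finiteness or countability is assumed; loops and parallel edges are allowed. -/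
structure DirGraph (V : Type u) (E : Type v) where
  s : E → V
  r : E → V

/-- The generators of a Leavitt path algebra: vertices `v`, edges `e` and ghost edges `e*`. -/
inductive LeavittGen (V : Type u) (E : Type v) where
  | vertex (v : V) : LeavittGen V E
  | edge (e : E) : LeavittGen V E
  | ghost (e : E) : LeavittGen V E

/-- The free (associative, not necessarily unital) `R`-algebra on the vertices, edges and ghost
edges: the semigroup algebra of the free semigroup. -/
abbrev LeavittFree (R : Type w) [CommRing R] (V : Type u) (E : Type v) :=
  MonoidAlgebra R (FreeSemigroup (LeavittGen V E))

/-- A generator as an element of the free algebra. -/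
noncomputable def LeavittFree.gen (R : Type w) [CommRing R] {V : Type u} {E : Type v}
    (a : LeavittGen V E) : LeavittFree R V E :=
  MonoidAlgebra.single (FreeSemigroup.of a) 1

open LeavittFree LeavittGen in
/-- The smallest `R`-algebra congruence on the free algebra which contains the defining relations
of the Leavitt path algebra. -/
inductive LeavittRel (R : Type w) [CommRing R] {V : Type u} {E : Type v} (Γ : DirGraph V E) :
    LeavittFree R V E → LeavittFree R V E → Prop
  -- the vertices are pairwise orthogonal idempotents
  | vertex_mul_self (v : V) :
      LeavittRel R Γ (gen R (vertex v) * gen R (vertex v)) (gen R (vertex v))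
  | vertex_mul_vertex (v v' : V) (h : v ≠ v') :
      LeavittRel R Γ (gen R (vertex v) * gen R (vertex v')) 0
  -- `s(e) e = e = e r(e)`
  | source_mul_edge (e : E) :
      LeavittRel R Γ (gen R (vertex (Γ.s e)) * gen R (edge e)) (gen R (edge e))
  | edge_mul_range (e : E) :
      LeavittRel R Γ (gen R (edge e) * gen R (vertex (Γ.r e))) (gen R (edge e))
  -- `r(e) e* = e* = e* s(e)`
  | range_mul_ghost (e : E) :
      LeavittRel R Γ (gen R (vertex (Γ.r e)) * gen R (ghost e)) (gen R (ghost e))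
  | ghost_mul_source (e : E) :
      LeavittRel R Γ (gen R (ghost e) * gen R (vertex (Γ.s e))) (gen R (ghost e))
  -- `e* e = r(e)`, and `e* f = 0` for `e ≠ f`
  | ghost_mul_self (e : E) :
      LeavittRel R Γ (gen R (ghost e) * gen R (edge e)) (gen R (vertex (Γ.r e)))
  | ghost_mul_edge (e f : E) (h : e ≠ f) :
      LeavittRel R Γ (gen R (ghost e) * gen R (edge f)) 0
  -- `v = ∑_{s(e) = v} e e*` for every regular vertex `v` (neither a sink nor an infinite emitter)
  | regular (v : V) (hfin : {e : E | Γ.s e = v}.Finite) (hne : {e : E | Γ.s e = v}.Nonempty) :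
      LeavittRel R Γ (gen R (vertex v)) (∑ e ∈ hfin.toFinset, gen R (edge e) * gen R (ghost e))
  -- closure under the operations of an `R`-algebra
  | refl (a : LeavittFree R V E) : LeavittRel R Γ a a
  | symm {a b : LeavittFree R V E} : LeavittRel R Γ a b → LeavittRel R Γ b a
  | trans {a b c : LeavittFree R V E} :
      LeavittRel R Γ a b → LeavittRel R Γ b c → LeavittRel R Γ a c
  | add {a b c d : LeavittFree R V E} :
      LeavittRel R Γ a b → LeavittRel R Γ c d → LeavittRel R Γ (a + c) (b + d)
  | mul {a b c d : LeavittFree R V E} :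
      LeavittRel R Γ a b → LeavittRel R Γ c d → LeavittRel R Γ (a * c) (b * d)
  | smul (t : R) {a b : LeavittFree R V E} :
      LeavittRel R Γ a b → LeavittRel R Γ (t • a) (t • b)

/-- `LeavittRel` as a ring congruence. -/
def leavittCon (R : Type w) [CommRing R] {V : Type u} {E : Type v} (Γ : DirGraph V E) :
    RingCon (LeavittFree R V E) where
  r := LeavittRel R Γ
  iseqv := ⟨LeavittRel.refl, LeavittRel.symm, LeavittRel.trans⟩
  add' := LeavittRel.add
  mul' := LeavittRel.mul

/-- The Leavitt path algebra `L_R(E)` of a directed graph over a commutative ring `R`. -/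
def LeavittPathAlgebra (R : Type w) [CommRing R] {V : Type u} {E : Type v} (Γ : DirGraph V E) :=
  (leavittCon R Γ).Quotient

namespace LeavittPathAlgebra

variable (R : Type w) [CommRing R] {V : Type u} {E : Type v} (Γ : DirGraph V E)

noncomputable instance : NonUnitalRing (LeavittPathAlgebra R Γ) :=
  inferInstanceAs (NonUnitalRing (leavittCon R Γ).Quotient)

/-- The quotient map from the free algebra. -/
noncomputable def mk (a : LeavittFree R V E) : LeavittPathAlgebra R Γ := RingCon.toQuotient a

theorem mk_eq {a b : LeavittFree R V E} : mk R Γ a = mk R Γ b ↔ LeavittRel R Γ a b :=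
  RingCon.eq _

theorem mk_surjective : Function.Surjective (mk R Γ) := fun y =>
  Quotient.inductionOn' y fun a => ⟨a, rfl⟩

noncomputable instance : SMul R (LeavittPathAlgebra R Γ) where
  smul t := Quotient.map' (fun a => t • a) fun _ _ h => LeavittRel.smul t h

theorem mk_zero : mk R Γ 0 = 0 := rfl

theorem mk_add (a b : LeavittFree R V E) : mk R Γ (a + b) = mk R Γ a + mk R Γ b := rfl

theorem mk_mul (a b : LeavittFree R V E) : mk R Γ (a * b) = mk R Γ a * mk R Γ b := rfl

theorem mk_smul (t : R) (a : LeavittFree R V E) : mk R Γ (t • a) = t • mk R Γ a := rfl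

noncomputable instance : Module R (LeavittPathAlgebra R Γ) :=
  Function.Surjective.module R
    (⟨⟨mk R Γ, mk_zero R Γ⟩, mk_add R Γ⟩ : LeavittFree R V E →+ LeavittPathAlgebra R Γ)
    (mk_surjective R Γ) (mk_smul R Γ)

instance : IsScalarTower R (LeavittPathAlgebra R Γ) (LeavittPathAlgebra R Γ) where
  smul_assoc t x y := by
    obtain ⟨a, rfl⟩ := mk_surjective R Γ x
    obtain ⟨b, rfl⟩ := mk_surjective R Γ y
    simp only [smul_eq_mul, ← mk_smul, ← mk_mul, smul_mul_assoc]

instance : SMulCommClass R (LeavittPathAlgebra R Γ) (LeavittPathAlgebra R Γ) where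
  smul_comm t x y := by
    obtain ⟨a, rfl⟩ := mk_surjective R Γ x
    obtain ⟨b, rfl⟩ := mk_surjective R Γ y
    simp only [smul_eq_mul, ← mk_smul, ← mk_mul, mul_smul_comm]

/-- The image of a generator in the Leavitt path algebra. -/
noncomputable def gen (a : LeavittGen V E) : LeavittPathAlgebra R Γ := mk R Γ (LeavittFree.gen R a)

/-- The vertex `v` as an element of the Leavitt path algebra. -/
noncomputable def vertex (v : V) : LeavittPathAlgebra R Γ := gen R Γ (LeavittGen.vertex v)

end LeavittPathAlgebra

/-- The grading of an `R`-algebra `A` (possibly without unit) by a group `G`: `A` is the internal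
direct sum of the submodules `A_g`, and `A_g A_h ⊆ A_{gh}`. -/
structure IsAlgebraGrading {G : Type x} [Group G] [DecidableEq G] {R : Type w} [CommRing R]
    {A : Type v} [NonUnitalRing A] [Module R A] (𝒜 : G → Submodule R A) : Prop where
  isInternal : DirectSum.IsInternal 𝒜
  mul_mem : ∀ ⦃g h : G⦄ ⦃a b : A⦄, a ∈ 𝒜 g → b ∈ 𝒜 h → a * b ∈ 𝒜 (g * h)

/-- The weight of a generator: `w(v) = 1`, and `w(e*) = w(e)⁻¹`. -/
def LeavittGen.weight {V : Type u} {E : Type v} {G : Type x} [Group G] (wt : E → G) :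
    LeavittGen V E → G
  | vertex _ => 1
  | edge e => wt e
  | ghost e => (wt e)⁻¹

namespace LeavittPathAlgebra

variable (R : Type w) [CommRing R] {V : Type u} {E : Type v} (Γ : DirGraph V E)
  {G : Type x} [Group G] (wt : E → G)

/-- The weight of a word in the generators is the product of the weights of its letters. -/
def wordWeight : FreeSemigroup (LeavittGen V E) →ₙ* G :=
  FreeSemigroup.lift (LeavittGen.weight wt)

/-- The image in the Leavitt path algebra of a word in the generators. -/
noncomputable def word (u : FreeSemigroup (LeavittGen V E)) : LeavittPathAlgebra R Γ :=
  mk R Γ (MonoidAlgebra.single u 1)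

/-- The `G`-grading of the Leavitt path algebra induced by the weight map `wt : E → G`: the
component of degree `g` is spanned by the words of weight `g`. -/
noncomputable def grading (g : G) : Submodule R (LeavittPathAlgebra R Γ) :=
  Submodule.span R {y | ∃ u : FreeSemigroup (LeavittGen V E), wordWeight wt u = g ∧ word R Γ u = y}


/-- The coaction `y ↦ y ⊗ w(y)` of `R[G]` on the Leavitt path algebra. -/
theorem exists_coaction : ∃ δ : LeavittPathAlgebra R Γ →ₗ[R]
    TensorProduct R (LeavittPathAlgebra R Γ) (MonoidAlgebra R G),
    ∀ u, δ (word R Γ u) = word R Γ u ⊗ₜ[R] MonoidAlgebra.single (wordWeight wt u) (1 : R) := by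
  classical
  let f : FreeSemigroup (LeavittGen V E) →ₙ*
      TensorProduct R (LeavittPathAlgebra R Γ) (MonoidAlgebra R G) :=
    { toFun u := word R Γ u ⊗ₜ[R] MonoidAlgebra.single (wordWeight wt u) (1 : R)
      map_mul' u u' := by
        rw [Algebra.TensorProduct.tmul_mul_tmul, MonoidAlgebra.single_mul_single, map_mul, word,
          word, word, ← mk_mul, MonoidAlgebra.single_mul_single, one_mul] }
  let F : LeavittFree R V E →ₙₐ[R] TensorProduct R (LeavittPathAlgebra R Γ) (MonoidAlgebra R G) :=
    MonoidAlgebra.liftMagma R f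
  have hF : ∀ u, F (MonoidAlgebra.single u 1) = f u := fun u => by
    simp [F, MonoidAlgebra.liftMagma]
  have hg : ∀ a, F (LeavittFree.gen R a) =
      gen R Γ a ⊗ₜ[R] MonoidAlgebra.single (LeavittGen.weight wt a) (1 : R) := fun a => hF _
  have hm : ∀ a b, F (LeavittFree.gen R a * LeavittFree.gen R b) =
      mk R Γ (LeavittFree.gen R a * LeavittFree.gen R b) ⊗ₜ[R]
        MonoidAlgebra.single (LeavittGen.weight wt a * LeavittGen.weight wt b) (1 : R) :=
    fun a b => by
      rw [map_mul, hg, hg, Algebra.TensorProduct.tmul_mul_tmul, MonoidAlgebra.single_mul_single,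
        one_mul, mk_mul]; rfl
  have hrel : ∀ a b, LeavittRel R Γ a b → F a = F b := by
    intro a b h
    induction h with
    | refl a => rfl
    | symm _ ih => exact ih.symm
    | trans _ _ ih ih' => exact ih.trans ih'
    | add _ _ ih ih' => rw [map_add, map_add, ih, ih']
    | mul _ _ ih ih' => rw [map_mul, map_mul, ih, ih']
    | smul t _ ih => rw [map_smul, map_smul, ih]
    | vertex_mul_self v =>
      rw [hm, hg, (mk_eq R Γ).2 (.vertex_mul_self v)]; simp [LeavittGen.weight, gen]
    | vertex_mul_vertex v v' h =>
      rw [hm, (mk_eq R Γ).2 (.vertex_mul_vertex v v' h)]; simp [mk_zero]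
    | source_mul_edge e =>
      rw [hm, hg, (mk_eq R Γ).2 (.source_mul_edge e)]; simp [LeavittGen.weight, gen]
    | edge_mul_range e =>
      rw [hm, hg, (mk_eq R Γ).2 (.edge_mul_range e)]; simp [LeavittGen.weight, gen]
    | range_mul_ghost e =>
      rw [hm, hg, (mk_eq R Γ).2 (.range_mul_ghost e)]; simp [LeavittGen.weight, gen]
    | ghost_mul_source e =>
      rw [hm, hg, (mk_eq R Γ).2 (.ghost_mul_source e)]; simp [LeavittGen.weight, gen]
    | ghost_mul_self e =>
      rw [hm, hg, (mk_eq R Γ).2 (.ghost_mul_self e)]; simp [LeavittGen.weight, gen]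
    | ghost_mul_edge e f h =>
      rw [hm, (mk_eq R Γ).2 (.ghost_mul_edge e f h)]; simp [mk_zero]
    | regular v hfin hne =>
      have hs : mk R Γ (∑ e ∈ hfin.toFinset, LeavittFree.gen R (.edge e) *
          LeavittFree.gen R (.ghost e)) = ∑ e ∈ hfin.toFinset,
          mk R Γ (LeavittFree.gen R (.edge e) * LeavittFree.gen R (.ghost e)) :=
        map_sum (⟨⟨mk R Γ, mk_zero R Γ⟩, mk_add R Γ⟩ : LeavittFree R V E →+ _) _ _
      rw [map_sum, hg, gen, (mk_eq R Γ).2 (.regular v hfin hne), hs, TensorProduct.sum_tmul]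
      refine Finset.sum_congr rfl fun e _ => ?_
      rw [hm]; simp [LeavittGen.weight]
  refine ⟨{ toFun := Quotient.lift (s := (leavittCon R Γ).toSetoid) F hrel
            map_add' := ?_, map_smul' := ?_ }, fun u => hF u⟩
  · intro y z
    obtain ⟨a, rfl⟩ := mk_surjective R Γ y
    obtain ⟨b, rfl⟩ := mk_surjective R Γ z
    exact map_add F a b
  · intro t y
    obtain ⟨a, rfl⟩ := mk_surjective R Γ y
    exact map_smul F t a

/-- The weight map does induce a grading of the Leavitt path algebra. -/
theorem isAlgebraGrading_grading [DecidableEq G] : IsAlgebraGrading (grading R Γ wt) where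
  isInternal := by
    obtain ⟨δ, hδ⟩ := exists_coaction R Γ wt
    have hδ' : ∀ g, ∀ y ∈ grading R Γ wt g, δ y = y ⊗ₜ[R] MonoidAlgebra.single g (1 : R) := by
      intro g y hy
      induction hy using Submodule.span_induction with
      | mem y hy => obtain ⟨u, rfl, rfl⟩ := hy; exact hδ u
      | zero => simp
      | add y z _ _ hy hz => rw [map_add, hy, hz, TensorProduct.add_tmul]
      | smul t y _ hy => rw [map_smul, hy, TensorProduct.smul_tmul']
    let ev : G → MonoidAlgebra R G →ₗ[R] R := fun g =>
      { toFun a := a.coeff g, map_add' _ _ := rfl, map_smul' _ _ := rfl }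
    let p : G → LeavittPathAlgebra R Γ →ₗ[R] LeavittPathAlgebra R Γ := fun g =>
      (TensorProduct.rid R _).toLinearMap ∘ₗ (ev g).lTensor _ ∘ₗ δ
    have hp : ∀ g h, ∀ y ∈ grading R Γ wt h, p g y = if h = g then y else 0 := by
      intro g h y hy
      simp only [p, LinearMap.comp_apply, hδ' h y hy, LinearMap.lTensor_tmul]
      have hev : ev g (MonoidAlgebra.single h 1) = if h = g then 1 else 0 := by
        change (MonoidAlgebra.single h (1 : R)).coeff g = _
        simp [Finsupp.single_apply]
      rw [hev]
      by_cases hgh : h = g <;> simp [hgh]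
    refine ⟨?_, ?_⟩
    · rw [injective_iff_map_eq_zero]
      intro a ha
      ext g
      have h1 : ∀ a : DirectSum G fun g => grading R Γ wt g,
          p g (DirectSum.coeAddMonoidHom (grading R Γ wt) a) = a g := by
        intro a
        induction a using DirectSum.induction_on with
        | zero => simp
        | of h y =>
          rw [DirectSum.coeAddMonoidHom_of, hp g h y y.2]
          by_cases hgh : h = g
          · subst hgh; simp
          · rw [if_neg hgh, DirectSum.of_eq_of_ne _ _ _ (Ne.symm hgh)]; rfl
        | add a b ha hb => rw [map_add, map_add, ha, hb]; rfl
      rw [← h1 a, ha, map_zero]; rfl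
    · intro y
      obtain ⟨a, rfl⟩ := mk_surjective R Γ y
      induction a using MonoidAlgebra.induction_linear with
      | zero => exact ⟨0, map_zero _⟩
      | add a b ha hb =>
        obtain ⟨a', ha⟩ := ha
        obtain ⟨b', hb⟩ := hb
        exact ⟨a' + b', by rw [map_add, ha, hb, mk_add]⟩
      | single u t =>
        refine ⟨DirectSum.of (fun g => grading R Γ wt g) (wordWeight wt u)
          ⟨t • word R Γ u, Submodule.smul_mem _ _ (Submodule.subset_span ⟨u, rfl, rfl⟩)⟩, ?_⟩
        rw [DirectSum.coeAddMonoidHom_of]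
        simp [word, ← mk_smul]
  mul_mem := by
    intro g h y z hy hz
    induction hy using Submodule.span_induction with
    | mem y hy =>
      obtain ⟨u, rfl, rfl⟩ := hy
      induction hz using Submodule.span_induction with
      | mem z hz =>
        obtain ⟨u', rfl, rfl⟩ := hz
        refine Submodule.subset_span ⟨u * u', map_mul _ _ _, ?_⟩
        rw [word, word, word, ← mk_mul, MonoidAlgebra.single_mul_single, one_mul]
      | zero => rw [mul_zero]; exact zero_mem _
      | add z z' _ _ hz hz' => rw [mul_add]; exact add_mem hz hz'
      | smul t z _ hz => rw [mul_smul_comm]; exact Submodule.smul_mem _ _ hz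
    | zero => rw [zero_mul]; exact zero_mem _
    | add y y' _ _ hy hy' => rw [add_mul]; exact add_mem hy hy'
    | smul t y _ hy => rw [smul_mul_assoc]; exact Submodule.smul_mem _ _ hy

end LeavittPathAlgebra

/-! Since `π` respects two internal direct sum decompositions, its kernel is graded, and it suffices
to treat a homogeneous `y` with `π y = 0`. Such a `y` is a combination of monomials `p q*` of one
weight. Right multiplication by a vertex isolates those whose ghost part ends at a fixed `v`, and
one inducts on a bound for the length of `q` (`eq_zero_of_mem_monomialSpan`).

With no ghost edges, `y` is a combination of paths of equal weight and range. As edges have weight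
`> 1`, none of these paths is a proper initial segment of another, so a suitable ghost path sends `y
≠ 0` to `t • v` with `t ≠ 0` (`exists_mul_eq_smul_vertex`), which `π` does not kill. The order is
used only here.

In the induction step, `y e` has a shorter ghost part for each edge `e` leaving `v`
(`mul_edge_mem_monomialSpan`), so `y e = 0`. At a regular `v`, `y = ∑ y e e* = 0`; at a sink there
is no ghost edge to remove; at an infinite emitter, an edge not occurring in `y` shows that the pure
path part vanishes, and then so does the rest. -/

namespace LeavittPathAlgebra

/-! ### Relations between generators; paths and ghost paths -/

section Relations

variable (R : Type w) [CommRing R] {V : Type u} {E : Type v} (Γ : DirGraph V E)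

/-- The edge `e` as an element of the Leavitt path algebra. -/
noncomputable def edge (e : E) : LeavittPathAlgebra R Γ := gen R Γ (LeavittGen.edge e)

/-- The ghost edge `e*` as an element of the Leavitt path algebra. -/
noncomputable def ghost (e : E) : LeavittPathAlgebra R Γ := gen R Γ (LeavittGen.ghost e)

theorem vertex_mul_self (v : V) : vertex R Γ v * vertex R Γ v = vertex R Γ v :=
  (mk_eq R Γ).2 (.vertex_mul_self v)

theorem vertex_mul_vertex {v v' : V} (h : v ≠ v') : vertex R Γ v * vertex R Γ v' = 0 :=
  (mk_eq R Γ).2 (.vertex_mul_vertex v v' h)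

theorem source_mul_edge (e : E) : vertex R Γ (Γ.s e) * edge R Γ e = edge R Γ e :=
  (mk_eq R Γ).2 (.source_mul_edge e)

theorem edge_mul_range (e : E) : edge R Γ e * vertex R Γ (Γ.r e) = edge R Γ e :=
  (mk_eq R Γ).2 (.edge_mul_range e)

theorem range_mul_ghost (e : E) : vertex R Γ (Γ.r e) * ghost R Γ e = ghost R Γ e :=
  (mk_eq R Γ).2 (.range_mul_ghost e)

theorem ghost_mul_source (e : E) : ghost R Γ e * vertex R Γ (Γ.s e) = ghost R Γ e :=
  (mk_eq R Γ).2 (.ghost_mul_source e)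

theorem ghost_mul_self (e : E) : ghost R Γ e * edge R Γ e = vertex R Γ (Γ.r e) :=
  (mk_eq R Γ).2 (.ghost_mul_self e)

theorem ghost_mul_edge {e f : E} (h : e ≠ f) : ghost R Γ e * edge R Γ f = 0 :=
  (mk_eq R Γ).2 (.ghost_mul_edge e f h)

theorem vertex_eq_sum {v : V} (hfin : {e : E | Γ.s e = v}.Finite)
    (hne : {e : E | Γ.s e = v}.Nonempty) :
    vertex R Γ v = ∑ e ∈ hfin.toFinset, edge R Γ e * ghost R Γ e :=
  ((mk_eq R Γ).2 (.regular v hfin hne)).trans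
    (map_sum (⟨⟨mk R Γ, mk_zero R Γ⟩, mk_add R Γ⟩ : LeavittFree R V E →+ _) _ _)

theorem vertex_mul_edge_of_ne {v : V} {e : E} (h : v ≠ Γ.s e) :
    vertex R Γ v * edge R Γ e = 0 := by
  rw [← source_mul_edge, ← mul_assoc, vertex_mul_vertex R Γ h, zero_mul]

/-- The product of the edges in the list `l` with the vertex `v`: a path with range `v`, or `0` if
the edges do not compose. -/
noncomputable def path (v : V) : List E → LeavittPathAlgebra R Γ
  | [] => vertex R Γ v
  | e :: l => edge R Γ e * path v l

/-- The ghost path of `path R Γ v l`. -/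
noncomputable def ghostPath (v : V) : List E → LeavittPathAlgebra R Γ
  | [] => vertex R Γ v
  | e :: l => ghostPath v l * ghost R Γ e

theorem path_mul_vertex (v : V) (l : List E) : path R Γ v l * vertex R Γ v = path R Γ v l := by
  induction l with
  | nil => exact vertex_mul_self R Γ v
  | cons e l ih => rw [path, mul_assoc, ih]

theorem path_mul_edge (e : E) (l : List E) :
    path R Γ (Γ.s e) l * edge R Γ e = path R Γ (Γ.r e) (l ++ [e]) := by
  induction l with
  | nil => simp only [path, List.nil_append, source_mul_edge, edge_mul_range]
  | cons f l ih => rw [path, mul_assoc, ih]; rfl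

/-- Lists of edges need not compose, so this dichotomy stands in for a composability condition. -/
theorem vertex_mul_path (u v : V) (l : List E) :
    vertex R Γ u * path R Γ v l = path R Γ v l ∨ vertex R Γ u * path R Γ v l = 0 := by
  cases l with
  | nil =>
    by_cases h : u = v
    · subst h; exact .inl (vertex_mul_self R Γ u)
    · exact .inr (vertex_mul_vertex R Γ h)
  | cons e l =>
    by_cases h : u = Γ.s e
    · subst h; left; rw [path, ← mul_assoc, source_mul_edge]
    · right; rw [path, ← mul_assoc, vertex_mul_edge_of_ne R Γ h, zero_mul]

theorem ghostPath_cons_mul_path_cons (v v' : V) (e : E) (l l' : List E) :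
    ghostPath R Γ v (e :: l) * path R Γ v' (e :: l') =
      ghostPath R Γ v l * (vertex R Γ (Γ.r e) * path R Γ v' l') := by
  rw [ghostPath, path, mul_assoc, ← mul_assoc (ghost R Γ e), ghost_mul_self]

/-- Each `e* e` collapses to `r(e)`, which the remaining path absorbs; `h` excludes lists whose
edges do not compose. -/
theorem ghostPath_mul_path_self (v : V) (l : List E) (h : path R Γ v l ≠ 0) :
    ghostPath R Γ v l * path R Γ v l = vertex R Γ v := by
  induction l with
  | nil => exact vertex_mul_self R Γ v
  | cons e l ih =>
    rw [ghostPath_cons_mul_path_cons]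
    rcases vertex_mul_path R Γ (Γ.r e) v l with h' | h'
    · rw [h', ih fun h0 => h (by rw [path, h0, mul_zero])]
    · exact absurd (by rw [path, ← edge_mul_range, mul_assoc, h', mul_zero]) h

end Relations

/-! ### Spans of monomials of given weight, filtered by ghost length -/

section Weight

variable (R : Type w) [CommRing R] {V : Type u} {E : Type v} (Γ : DirGraph V E)
  {G : Type x} [Group G] (wt : E → G)

/-- The span of the paths with range `v` and weight `g`. -/
noncomputable def pathSpan (g : G) (v : V) : Submodule R (LeavittPathAlgebra R Γ) :=
  Submodule.span R (path R Γ v '' {l | (l.map wt).prod = g})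

/-- The span of the products of a path and a ghost path of length at most `n`, of total weight `g`
and such that the ghost path ends at `v`. -/
noncomputable def monomialSpan : ℕ → G → V → Submodule R (LeavittPathAlgebra R Γ)
  | 0, g, v => pathSpan R Γ wt g v
  -- Removing a final `e*`, of weight `(wt e)⁻¹`, leaves weight `g * wt e` and right end `r(e)`.
  | n + 1, g, v => pathSpan R Γ wt g v ⊔ ⨆ e : {e : E // Γ.s e = v},
      (monomialSpan n (g * wt e) (Γ.r e)).map (LinearMap.mulRight R (ghost R Γ e))

theorem mul_vertex_of_mem_pathSpan {g : G} {v : V} {y : LeavittPathAlgebra R Γ}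
    (hy : y ∈ pathSpan R Γ wt g v) : y * vertex R Γ v = y := by
  induction hy using Submodule.span_induction with
  | mem y hy => obtain ⟨l, -, rfl⟩ := hy; exact path_mul_vertex R Γ v l
  | zero => exact zero_mul _
  | add y z _ _ hy hz => rw [add_mul, hy, hz]
  | smul t y _ hy => rw [smul_mul_assoc, hy]

theorem mul_edge_mem_pathSpan {g : G} {e : E} {y : LeavittPathAlgebra R Γ}
    (hy : y ∈ pathSpan R Γ wt g (Γ.s e)) :
    y * edge R Γ e ∈ pathSpan R Γ wt (g * wt e) (Γ.r e) := by
  induction hy using Submodule.span_induction with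
  | mem y hy =>
    obtain ⟨l, rfl, rfl⟩ := hy
    exact Submodule.subset_span ⟨l ++ [e], by simp, (path_mul_edge R Γ e l).symm⟩
  | zero => rw [zero_mul]; exact zero_mem _
  | add y z _ _ hy hz => rw [add_mul]; exact add_mem hy hz
  | smul t y _ hy => rw [smul_mul_assoc]; exact Submodule.smul_mem _ _ hy

theorem pathSpan_le_monomialSpan (n : ℕ) (g : G) (v : V) :
    pathSpan R Γ wt g v ≤ monomialSpan R Γ wt n g v := by
  cases n with
  | zero => exact le_rfl
  | succ n => exact le_sup_left

theorem mul_ghost_mem_monomialSpan {n : ℕ} {g : G} {e : E} {y : LeavittPathAlgebra R Γ}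
    (hy : y ∈ monomialSpan R Γ wt n g (Γ.r e)) :
    y * ghost R Γ e ∈ monomialSpan R Γ wt (n + 1) (g * (wt e)⁻¹) (Γ.s e) := by
  refine Submodule.mem_sup_right (Submodule.mem_iSup_of_mem ⟨e, rfl⟩ ⟨y, ?_, rfl⟩)
  simpa using hy

theorem exists_eq_add_sum_of_mem_monomialSpan {n : ℕ} {g : G} {v : V}
    {y : LeavittPathAlgebra R Γ} (hy : y ∈ monomialSpan R Γ wt (n + 1) g v) :
    ∃ y₀ ∈ pathSpan R Γ wt g v, ∃ (F : Finset {e : E // Γ.s e = v})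
      (z : {e : E // Γ.s e = v} → LeavittPathAlgebra R Γ),
      (∀ e : {e : E // Γ.s e = v}, z e ∈ monomialSpan R Γ wt n (g * wt e) (Γ.r e)) ∧
      y = y₀ + ∑ e ∈ F, z e * ghost R Γ e := by
  obtain ⟨y₀, hy₀, y₁, hy₁, rfl⟩ := Submodule.mem_sup.1 hy
  obtain ⟨f, hf, rfl⟩ := (Submodule.mem_iSup_iff_exists_finsupp _ _).1 hy₁
  choose z hz hzf using hf
  exact ⟨y₀, hy₀, f.support, z, hz, by
    rw [Finsupp.sum, Finset.sum_congr rfl fun e _ => (hzf e).symm]; rfl⟩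

theorem mul_vertex_of_mem_monomialSpan {n : ℕ} {g : G} {v : V} {y : LeavittPathAlgebra R Γ}
    (hy : y ∈ monomialSpan R Γ wt n g v) : y * vertex R Γ v = y := by
  cases n with
  | zero => exact mul_vertex_of_mem_pathSpan R Γ wt hy
  | succ n =>
    obtain ⟨y₀, hy₀, F, z, -, rfl⟩ := exists_eq_add_sum_of_mem_monomialSpan R Γ wt hy
    rw [add_mul, mul_vertex_of_mem_pathSpan R Γ wt hy₀, Finset.sum_mul]
    congr 1
    refine Finset.sum_congr rfl fun ⟨e, he⟩ _ => ?_
    subst he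
    rw [mul_assoc, ghost_mul_source]

theorem mul_vertex_of_mem_monomialSpan_of_ne {n : ℕ} {g : G} {v u : V}
    {y : LeavittPathAlgebra R Γ} (hy : y ∈ monomialSpan R Γ wt n g v) (h : v ≠ u) :
    y * vertex R Γ u = 0 := by
  rw [← mul_vertex_of_mem_monomialSpan R Γ wt hy, mul_assoc, vertex_mul_vertex R Γ h, mul_zero]

open Classical in
/-- Right multiplication by an edge picks out one summand of the decomposition by last letter. -/
theorem add_sum_mul_edge {n : ℕ} {g : G} {v : V} (y₀ : LeavittPathAlgebra R Γ)
    (F : Finset {e : E // Γ.s e = v}) {z : {e : E // Γ.s e = v} → LeavittPathAlgebra R Γ}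
    (hz : ∀ e : {e : E // Γ.s e = v}, z e ∈ monomialSpan R Γ wt n (g * wt e) (Γ.r e))
    (e : {e : E // Γ.s e = v}) :
    (y₀ + ∑ f ∈ F, z f * ghost R Γ f) * edge R Γ e =
      y₀ * edge R Γ e + if e ∈ F then z e else 0 := by
  rw [add_mul, Finset.sum_mul, ← Finset.sum_ite_eq F e z]
  congr 1
  refine Finset.sum_congr rfl fun f _ => ?_
  rw [mul_assoc]
  split_ifs with h
  · rw [← h, ghost_mul_self, mul_vertex_of_mem_monomialSpan R Γ wt (hz e)]
  · rw [ghost_mul_edge R Γ fun h' => h (Subtype.ext h'.symm), mul_zero]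

/-- An edge either lengthens a pure path or cancels the last ghost edge, so the bound on the ghost
length drops. This drives the main induction. -/
theorem mul_edge_mem_monomialSpan {n : ℕ} {g : G} {e : E} {y : LeavittPathAlgebra R Γ}
    (hy : y ∈ monomialSpan R Γ wt (n + 1) g (Γ.s e)) :
    y * edge R Γ e ∈ monomialSpan R Γ wt n (g * wt e) (Γ.r e) := by
  obtain ⟨y₀, hy₀, F, z, hz, rfl⟩ := exists_eq_add_sum_of_mem_monomialSpan R Γ wt hy
  rw [add_sum_mul_edge R Γ wt y₀ F hz ⟨e, rfl⟩]
  refine add_mem (pathSpan_le_monomialSpan R Γ wt n _ _ (mul_edge_mem_pathSpan R Γ wt hy₀)) ?_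
  split_ifs
  · exact hz ⟨e, rfl⟩
  · exact zero_mem _

theorem monomialSpan_le_succ (n : ℕ) (g : G) (v : V) :
    monomialSpan R Γ wt n g v ≤ monomialSpan R Γ wt (n + 1) g v := by
  induction n generalizing g v with
  | zero => exact pathSpan_le_monomialSpan R Γ wt 1 g v
  | succ n ih => exact sup_le_sup_left (iSup_mono fun e => Submodule.map_mono (ih _ _)) _

theorem monomialSpan_monotone (g : G) (v : V) :
    Monotone fun n => monomialSpan R Γ wt n g v :=
  monotone_nat_of_le_succ fun n => monomialSpan_le_succ R Γ wt n g v

theorem mul_gen_mem_iSup_monomialSpan {g : G} {y : LeavittPathAlgebra R Γ}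
    (hy : y ∈ ⨆ v, ⨆ n, monomialSpan R Γ wt n g v) (a : LeavittGen V E) :
    y * gen R Γ a ∈ ⨆ v, ⨆ n, monomialSpan R Γ wt n (g * a.weight wt) v := by
  have hmem : ∀ {n h v z}, z ∈ monomialSpan R Γ wt n h v →
      z ∈ ⨆ v, ⨆ n, monomialSpan R Γ wt n h v := fun {n h v z} hz =>
    Submodule.mem_iSup_of_mem v (Submodule.mem_iSup_of_mem n hz)
  have hle : ⨆ v, ⨆ n, monomialSpan R Γ wt n g v ≤
      (⨆ v, ⨆ n, monomialSpan R Γ wt n (g * a.weight wt) v).comap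
        (LinearMap.mulRight R (gen R Γ a)) := by
    refine iSup_le fun v => iSup_le fun n y hy => ?_
    rw [Submodule.mem_comap, LinearMap.mulRight_apply]
    cases a with
    | vertex u =>
      change y * vertex R Γ u ∈ _
      rw [LeavittGen.weight, mul_one]
      by_cases h : v = u
      · subst h
        rw [mul_vertex_of_mem_monomialSpan R Γ wt hy]
        exact hmem hy
      · rw [mul_vertex_of_mem_monomialSpan_of_ne R Γ wt hy h]
        exact zero_mem _
    | edge e =>
      change y * edge R Γ e ∈ _
      by_cases h : v = Γ.s e
      · subst h
        -- The bound is first raised to `n + 1`, so that it can drop even when `n = 0`.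
        exact hmem (mul_edge_mem_monomialSpan R Γ wt (monomialSpan_le_succ R Γ wt n _ _ hy))
      · rw [← source_mul_edge, ← mul_assoc, mul_vertex_of_mem_monomialSpan_of_ne R Γ wt hy h,
          zero_mul]
        exact zero_mem _
    | ghost e =>
      change y * ghost R Γ e ∈ _
      by_cases h : v = Γ.r e
      · subst h
        exact hmem (mul_ghost_mem_monomialSpan R Γ wt hy)
      · rw [← range_mul_ghost, ← mul_assoc, mul_vertex_of_mem_monomialSpan_of_ne R Γ wt hy h,
          zero_mul]
        exact zero_mem _
  exact hle hy

theorem vertex_mem_iSup_monomialSpan (v : V) :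
    vertex R Γ v ∈ ⨆ v, ⨆ n, monomialSpan R Γ wt n 1 v :=
  Submodule.mem_iSup_of_mem v (Submodule.mem_iSup_of_mem 0
    (Submodule.subset_span ⟨[], by simp, rfl⟩))

theorem exists_vertex_mul_gen (a : LeavittGen V E) :
    ∃ v, vertex R Γ v * gen R Γ a = gen R Γ a := by
  cases a with
  | vertex v => exact ⟨v, vertex_mul_self R Γ v⟩
  | edge e => exact ⟨_, source_mul_edge R Γ e⟩
  | ghost e => exact ⟨_, range_mul_ghost R Γ e⟩

theorem word_mul (u u' : FreeSemigroup (LeavittGen V E)) :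
    word R Γ (u * u') = word R Γ u * word R Γ u' := by
  rw [word, word, word, ← mk_mul, MonoidAlgebra.single_mul_single, one_mul]

theorem mul_word_mem_iSup_monomialSpan (u : FreeSemigroup (LeavittGen V E)) {g : G}
    {y : LeavittPathAlgebra R Γ} (hy : y ∈ ⨆ v, ⨆ n, monomialSpan R Γ wt n g v) :
    y * word R Γ u ∈ ⨆ v, ⨆ n, monomialSpan R Γ wt n (g * wordWeight wt u) v := by
  induction u using FreeSemigroup.recOnMul generalizing g y with
  | ih1 a => exact mul_gen_mem_iSup_monomialSpan R Γ wt hy a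
  | ih2 a u iha ihu =>
    rw [word_mul, ← mul_assoc, map_mul, ← mul_assoc]
    exact ihu (iha hy)

theorem exists_vertex_mul_word (u : FreeSemigroup (LeavittGen V E)) :
    ∃ v, vertex R Γ v * word R Γ u = word R Γ u := by
  induction u using FreeSemigroup.recOnMul with
  | ih1 a => exact exists_vertex_mul_gen R Γ a
  | ih2 a u iha _ =>
    obtain ⟨v, hv⟩ := iha
    exact ⟨v, by rw [word_mul, ← mul_assoc, hv]⟩

/-- A word is fixed on the left by some vertex, itself a path of weight `1`; multiplying that vertex
by the letters one at a time never leaves the spans. -/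
theorem grading_le_iSup_monomialSpan (g : G) :
    grading R Γ wt g ≤ ⨆ v, ⨆ n, monomialSpan R Γ wt n g v := by
  refine Submodule.span_le.2 ?_
  rintro _ ⟨u, rfl, rfl⟩
  obtain ⟨v, hv⟩ := exists_vertex_mul_word R Γ u
  have h := mul_word_mem_iSup_monomialSpan R Γ wt u (vertex_mem_iSup_monomialSpan R Γ wt v)
  rwa [hv, one_mul] at h

end Weight

/-! ### Positive weights and injectivity on homogeneous elements -/

section Ordered

variable (R : Type w) [CommRing R] {V : Type u} {E : Type v} (Γ : DirGraph V E)
  {G : Type x} [Group G] [LinearOrder G] [MulLeftMono G] {wt : E → G}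

theorem one_le_prod_map_weight (hwt : ∀ e, 1 < wt e) (l : List E) : 1 ≤ (l.map wt).prod := by
  induction l with
  | nil => simp
  | cons e l ih => rw [List.map_cons, List.prod_cons]; exact one_le_mul (hwt e).le ih

theorem prod_map_weight_cons_ne_one (hwt : ∀ e, 1 < wt e) (e : E) (l : List E) :
    ((e :: l).map wt).prod ≠ 1 := by
  rw [List.map_cons, List.prod_cons]
  exact ((hwt e).trans_le (le_mul_of_one_le_right' (one_le_prod_map_weight hwt l))).ne'

/-- Different paths of the same weight are not initial segments of each other. -/
theorem ghostPath_mul_path_of_ne (hwt : ∀ e, 1 < wt e) (v : V) {l l' : List E}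
    (hw : (l.map wt).prod = (l'.map wt).prod) (h : l ≠ l') :
    ghostPath R Γ v l * path R Γ v l' = 0 := by
  induction l generalizing l' with
  | nil =>
    cases l' with
    | nil => exact absurd rfl h
    | cons e l' => exact absurd hw.symm (prod_map_weight_cons_ne_one hwt e l')
  | cons e l ih =>
    cases l' with
    | nil => exact absurd hw (prod_map_weight_cons_ne_one hwt e l)
    | cons f l' =>
      by_cases hef : e = f
      · subst hef
        rw [ghostPath_cons_mul_path_cons]
        rcases vertex_mul_path R Γ (Γ.r e) v l' with h' | h'
        · rw [h']
          exact ih (by simpa using hw) fun h'' => h (by rw [h''])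
        · rw [h', mul_zero]
      · rw [ghostPath, path, mul_assoc, ← mul_assoc (ghost R Γ e), ghost_mul_edge R Γ hef,
          zero_mul, mul_zero]

theorem exists_mul_eq_smul_vertex (hwt : ∀ e, 1 < wt e) {g : G} {v : V}
    {y : LeavittPathAlgebra R Γ} (hy : y ∈ pathSpan R Γ wt g v) (h0 : y ≠ 0) :
    ∃ (a : LeavittPathAlgebra R Γ) (t : R), t ≠ 0 ∧ a * y = t • vertex R Γ v := by
  obtain ⟨c, hc, rfl⟩ := (Finsupp.mem_span_image_iff_linearCombination R).1 hy
  rw [Finsupp.linearCombination_apply, Finsupp.sum] at h0 ⊢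
  -- The whole term must be nonzero, not just its coefficient: then the path is nonzero and
  -- `ghostPath_mul_path_self` applies.
  obtain ⟨l, hl, hne⟩ := Finset.exists_ne_zero_of_sum_ne_zero h0
  refine ⟨ghostPath R Γ v l, c l, Finsupp.mem_support_iff.1 hl, ?_⟩
  rw [Finset.mul_sum, Finset.sum_eq_single_of_mem l hl]
  · rw [mul_smul_comm, ghostPath_mul_path_self]
    exact fun h => hne (by rw [h, smul_zero])
  · intro l' hl' hll'
    have hw : (l.map wt).prod = (l'.map wt).prod :=
      ((Finsupp.mem_supported R c).1 hc hl).trans ((Finsupp.mem_supported R c).1 hc hl').symm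
    rw [mul_smul_comm, ghostPath_mul_path_of_ne R Γ hwt v hw hll'.symm, smul_zero]

variable {R Γ} {A : Type*} [NonUnitalRing A] [Module R A]

theorem eq_zero_of_mem_monomialSpan (hwt : ∀ e, 1 < wt e) (π : LeavittPathAlgebra R Γ →ₙₐ[R] A)
    (hv : ∀ (v : V) (t : R), t ≠ 0 → π (t • vertex R Γ v) ≠ 0) {n : ℕ} {g : G} {v : V}
    {y : LeavittPathAlgebra R Γ} (hy : y ∈ monomialSpan R Γ wt n g v) (hπ : π y = 0) : y = 0 := by
  classical
  have hpath : ∀ {g v y}, y ∈ pathSpan R Γ wt g v → π y = 0 → y = 0 := by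
    intro g v y hy hπ
    by_contra h0
    obtain ⟨a, t, ht, ha⟩ := exists_mul_eq_smul_vertex R Γ hwt hy h0
    exact hv v t ht (by rw [← ha, map_mul, hπ, mul_zero])
  induction n generalizing g v y with
  | zero => exact hpath hy hπ
  | succ n ih =>
    have hedge : ∀ e : {e : E // Γ.s e = v}, y * edge R Γ e = 0 := by
      rintro ⟨e, rfl⟩
      exact ih (mul_edge_mem_monomialSpan R Γ wt hy) (by rw [map_mul, hπ, zero_mul])
    have hyv := mul_vertex_of_mem_monomialSpan R Γ wt hy
    obtain ⟨y₀, hy₀, F, z, hz, hyF⟩ := exists_eq_add_sum_of_mem_monomialSpan R Γ wt hy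
    -- If `F` exhausts the edges leaving `v`, then `v` is a sink or regular; every infinite emitter
    -- falls in the other case.
    by_cases hF : ∀ e, e ∈ F
    · have hfin : {e : E | Γ.s e = v}.Finite :=
        Set.finite_coe_iff.1 (@Finite.of_fintype {e : E // Γ.s e = v} ⟨F, hF⟩)
      rcases Set.eq_empty_or_nonempty {e : E | Γ.s e = v} with hemp | hne
      · have hF0 : F = ∅ := Finset.eq_empty_of_forall_notMem fun e _ => by
          have : e.1 ∈ {e : E | Γ.s e = v} := e.2
          simp [hemp] at this
        rw [hF0, Finset.sum_empty, add_zero] at hyF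
        exact hpath (hyF ▸ hy₀) hπ
      · rw [← hyv, vertex_eq_sum R Γ hfin hne, Finset.mul_sum]
        refine Finset.sum_eq_zero fun e he => ?_
        rw [← mul_assoc, hedge ⟨e, by simpa using he⟩, zero_mul]
    · push Not at hF
      obtain ⟨e, he⟩ := hF
      -- Since `e ∉ F`, multiplying by `e` annihilates every term that ends in a ghost edge.
      have hy₀e : y₀ * edge R Γ e = 0 := by
        have h := hedge e
        rwa [hyF, add_sum_mul_edge R Γ wt y₀ F hz, if_neg he, add_zero] at h
      have hy₀0 : y₀ = 0 := by
        by_contra h0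
        obtain ⟨a, t, ht, ha⟩ := exists_mul_eq_smul_vertex R Γ hwt hy₀ h0
        refine hv (Γ.r e) t ht ?_
        -- From `a y₀ = t v` follows `t e = a y₀ e = 0`, hence `t r(e) = e* (t e) = 0`, against `hv`
        -- at `r(e)`.
        have h : t • edge R Γ e.1 = 0 := by
          obtain ⟨e, rfl⟩ := e
          rw [← source_mul_edge R Γ e, ← smul_mul_assoc, ← ha, mul_assoc, hy₀e, mul_zero]
        rw [← ghost_mul_self, ← mul_smul_comm, h, mul_zero, map_zero]
      rw [hyF, hy₀0, zero_add]
      refine Finset.sum_eq_zero fun f hf => ?_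
      have h := hedge f
      rw [hyF, add_sum_mul_edge R Γ wt y₀ F hz, if_pos hf, hy₀0, zero_mul, zero_add] at h
      rw [h, zero_mul]

theorem eq_zero_of_mem_grading (hwt : ∀ e, 1 < wt e) (π : LeavittPathAlgebra R Γ →ₙₐ[R] A)
    (hv : ∀ (v : V) (t : R), t ≠ 0 → π (t • vertex R Γ v) ≠ 0) {g : G}
    {y : LeavittPathAlgebra R Γ} (hy : y ∈ grading R Γ wt g) (hπ : π y = 0) : y = 0 := by
  classical
  obtain ⟨f, hf, rfl⟩ := (Submodule.mem_iSup_iff_exists_finsupp _ _).1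
    (grading_le_iSup_monomialSpan R Γ wt g hy)
  have hmem : ∀ v, ∃ n, f v ∈ monomialSpan R Γ wt n g v := fun v =>
    (Submodule.mem_iSup_of_directed _ (monomialSpan_monotone R Γ wt g v).directed_le).1 (hf v)
  refine Finset.sum_eq_zero fun v hvf => ?_
  obtain ⟨n, hn⟩ := hmem v
  refine eq_zero_of_mem_monomialSpan hwt π hv hn ?_
  -- Right multiplication by `v` projects onto the component ending at `v`, so `π` kills each
  -- component separately.
  have h : (f.sum fun _ y => y) * vertex R Γ v = f v := by
    rw [Finsupp.sum, Finset.sum_mul, Finset.sum_eq_single_of_mem v hvf]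
    · exact mul_vertex_of_mem_monomialSpan R Γ wt hn
    · intro u _ huv
      obtain ⟨m, hm⟩ := hmem u
      exact mul_vertex_of_mem_monomialSpan_of_ne R Γ wt hm huv
  rw [← h, map_mul, hπ, zero_mul]

end Ordered

end LeavittPathAlgebra

/-! ### Reduction to homogeneous elements -/

theorem mainTheorem9 {V : Type*} {E : Type*} {G : Type*} {R : Type*} {A : Type*}
    [Group G] [LinearOrder G] [MulLeftMono G] [MulRightMono G] [CommRing R]
    [NonUnitalRing A] [Module R A] [IsScalarTower R A A] [SMulCommClass R A A]
    (Γ : DirGraph V E) (wt : E → {g : G // 1 < g})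
    (𝒜 : G → Submodule R A) (h𝒜 : IsAlgebraGrading 𝒜)
    (π : LeavittPathAlgebra R Γ →ₙₐ[R] A)
    (hπ : ∀ g : G, ∀ y ∈ LeavittPathAlgebra.grading R Γ (fun e => (wt e : G)) g, π y ∈ 𝒜 g)
    (hv : ∀ (v : V) (t : R), t ≠ 0 → π (t • LeavittPathAlgebra.vertex R Γ v) ≠ 0) :
    Function.Injective π := by
  classical
  have hwt : ∀ e, (1 : G) < wt e := fun e => (wt e).2
  have hL := (LeavittPathAlgebra.isAlgebraGrading_grading R Γ fun e => (wt e : G)).isInternal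
  rw [injective_iff_map_eq_zero]
  intro y hy
  obtain ⟨a, rfl⟩ := hL.2 y
  let φ : (DirectSum G fun g => LeavittPathAlgebra.grading R Γ (fun e => (wt e : G)) g) →+
      DirectSum G fun g => 𝒜 g :=
    DirectSum.map fun g => (((π : LeavittPathAlgebra R Γ →ₗ[R] A).restrict (hπ g)).toAddMonoidHom)
  -- `φ` is `π` acting degree by degree; as the sum in `A` is direct, `π y = 0` forces every
  -- component of `y` into the kernel.
  have hφ : ∀ b, DirectSum.coeAddMonoidHom 𝒜 (φ b) = π (DirectSum.coeAddMonoidHom _ b) := by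
    intro b
    induction b using DirectSum.induction_on with
    | zero => simp
    | of g b => simp only [φ, DirectSum.map_of, DirectSum.coeAddMonoidHom_of]; rfl
    | add b c hb hc => simp only [map_add, hb, hc]
  have hφa : φ a = 0 := h𝒜.isInternal.1 (by rw [hφ, hy, map_zero])
  have ha : a = 0 := by
    ext g
    refine LeavittPathAlgebra.eq_zero_of_mem_grading hwt π hv (a g).2 ?_
    have h : ((φ a) g : A) = 0 := by rw [hφa]; rfl
    rwa [DirectSum.map_apply] at h
  rw [ha, map_zero]
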